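/- Let $M\in\mathbb R^{n\times n}$, $q\in\mathbb R^n$ and let $s$ be a nonnegative integer. For $x\in\mathbb R^n$ let $\|x\|_0$ be the number of nonzero entries of $x$, let $S=\{x:\|x\|_0\le s\}$, and put $$\mathrm{sol}(M,q)=\{x: x\ge 0,\ Mx+q\ge 0,\ \langle x,Mx+q\rangle=0\},$$ $$\mathrm{fea}_s(M,q)=\{x: x\ge 0,\ Mx+q\ge 0,\ \|x\|_0\le s\},$$ $$Q_s(M,q)=\{x\in \mathrm{fea}_s(M,q): \langle x,Mx+q\rangle\le\langle z,Mz+q\rangle\ \text{ for all } z\in\mathrm{fea}_s(M,q)\}.$$ For a given $x$ write $T=\{i:x_i\neq 0\}$ and $\Gamma=\{i:(Mx+q)_i=0\}$; $M_T$ is the submatrix of the columns of $M$ indexed by $T$, $M_{T\Gamma}$ is the submatrix with rows in $T$ and columns in $\Gamma$, and $q_T$ is the subvector of $q$ indexed by $T$. A Z-matrix is a matrix whose off-diagonal entries are all nonpositive. Assume that $\mathrm{fea}_s(M,q)$ is nonempty. Then $Q_s(M,q)$ is nonempty, and every $x\in Q_s(M,q)$ that satisfies at least one of the following conditions belongs to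 $\mathrm{sol}(M,q)\cap S$: 1. $\|x\|_0=s$, $M$ is a symmetric Z-matrix, $\operatorname{rank}(M_T)=|T|$, and $q_T\le 0$. 2. $\|x\|_0<s$, $M$ is a symmetric Z-matrix, $\operatorname{rank}(M_{T\Gamma})=|\Gamma|$, and $q_T\le 0$. 3. $\|x\|_0<s$, $M$ is symmetric positive semidefinite, and $\operatorname{rank}(M_{T\Gamma})=|\Gamma|$. -/

import Mathlib

open scoped Matrix

namespace SparseLCP

variable {n : ℕ}

/-- The solution set `sol(M, q)` of the linear complementarity problem. -/
def sol (M : Matrix (Fin n) (Fin n) ℝ) (q : Fin n → ℝ) : Set (Fin n → ℝ) :=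
  {x | (∀ i, 0 ≤ x i) ∧ (∀ i, 0 ≤ (M *ᵥ x + q) i) ∧ x ⬝ᵥ (M *ᵥ x + q) = 0}

/-- The feasible set `fea(M, q)` of the linear complementarity problem. -/
def fea (M : Matrix (Fin n) (Fin n) ℝ) (q : Fin n → ℝ) : Set (Fin n → ℝ) :=
  {x | (∀ i, 0 ≤ x i) ∧ (∀ i, 0 ≤ (M *ᵥ x + q) i)}

/-- The support `T = supp(x)`. -/
noncomputable def supp (x : Fin n → ℝ) : Finset (Fin n) :=
  Finset.univ.filter fun i => x i ≠ 0

/-- The zero norm `‖x‖₀`: the number of nonzero entries of `x`. -/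
noncomputable def zeroNorm (x : Fin n → ℝ) : ℕ := (supp x).card

/-- The sparse set `S` of the vectors with at most `s` nonzero entries. -/
def sparse (n s : ℕ) : Set (Fin n → ℝ) := {x | zeroNorm x ≤ s}

/-- The feasible set `fea_s(M, q)` of the sparse linear complementarity problem. -/
def feaS (s : ℕ) (M : Matrix (Fin n) (Fin n) ℝ) (q : Fin n → ℝ) : Set (Fin n → ℝ) :=
  fea M q ∩ sparse n s

/-- `Q_s(M, q)`: the set of global minimizers of `⟨x, M x + q⟩` over `fea_s(M, q)`. -/
def argminS (s : ℕ) (M : Matrix (Fin n) (Fin n) ℝ) (q : Fin n → ℝ) : Set (Fin n → ℝ) :=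
  {x | x ∈ feaS s M q ∧ ∀ z ∈ feaS s M q, x ⬝ᵥ (M *ᵥ x + q) ≤ z ⬝ᵥ (M *ᵥ z + q)}

/-- The index set `Γ` of the indices `i` with `(M x + q) i = 0`. -/
noncomputable def activeSet (M : Matrix (Fin n) (Fin n) ℝ) (q x : Fin n → ℝ) : Finset (Fin n) :=
  Finset.univ.filter fun i => (M *ᵥ x + q) i = 0

/-- A Z-matrix: all off-diagonal entries are nonpositive. -/
def IsZMatrix (M : Matrix (Fin n) (Fin n) ℝ) : Prop := ∀ i j, i ≠ j → M i j ≤ 0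

/-- `M_T`: the submatrix of the columns of `M` indexed by `T` (all rows are kept). -/
def colSub (M : Matrix (Fin n) (Fin n) ℝ) (T : Finset (Fin n)) : Matrix (Fin n) T ℝ :=
  M.submatrix id (fun j : T => (j : Fin n))

/-- `M_{T₁ T₂}`: the submatrix of the rows indexed by `T₁` and the columns indexed by `T₂`. -/
def blockSub (M : Matrix (Fin n) (Fin n) ℝ) (T₁ T₂ : Finset (Fin n)) : Matrix T₁ T₂ ℝ :=
  M.submatrix (fun i : T₁ => (i : Fin n)) (fun j : T₂ => (j : Fin n))

end SparseLCP

/-!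
The objective `f x = ⟨x, M x + q⟩` is nonnegative on the feasible set `F = fea_s(M, q)`.

*Existence of a minimizer* (`argminS_nonempty`) is a Frank–Wolfe argument that works directly on the
nonconvex set `F`. For every `k`, pick in `{x ∈ F | f x ≤ inf f + 1 / (k + 1)}` a point `u k` with
the smallest coordinate sum. If the sums do not tend to infinity, a cluster point of `u` is a
minimizer. Otherwise the points `u k`, divided by their sums, accumulate at some `d ≥ 0`, `d ≠ 0`,
with `M d ≥ 0` and `⟨d, M d⟩ = 0`. Along `d` the objective is affine, and nonnegative on the ray
`u k + t d`, so it does not increase when one steps back to `u k - t d`. For large `k`, the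
coordinates of `u k` and of `M (u k) + q` are positive wherever those of `d` and `M d` are, so a
short step back stays in `F` and has a smaller sum, a contradiction
(`exists_smaller_sum_of_recession`).

*Optimality.* A minimizer has nonnegative slope in each direction in which a short step stays in `F`
(`slope_nonneg_of_mem_argminS`). Put `y = M x + q`.

* If `M` is a symmetric Z-matrix, `q ≤ 0` on the support of `x`, and `x i > 0`, `y i > 0`, then
  decreasing `x i` is feasible, since the off-diagonal entries of `M` are nonpositive; it strictly
  decreases `f`, the slope being `-(2 y i - q i)`. So `x` and `y` are complementary
  (`complementary_of_isZMatrix`).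
* If `M` is positive semidefinite and the rank condition holds, the rows of `M` indexed by `Γ`,
  restricted to the columns in `T`, map onto `ℝ^Γ`. This yields multipliers `l, μ ≥ 0` with
  `M x + y = M l + μ`, `l` orthogonal to `y` and `μ` orthogonal to `x` (`exists_multipliers`); the
  spare coordinate allowed by `‖x‖₀ < s` gives the sign of `μ` off `T`. Then
  `0 ≤ ⟨x - l, M (x - l)⟩ = ⟨x - l, μ - y⟩ = -⟨x, y⟩ - ⟨l, μ⟩`, so `⟨x, y⟩ = 0`.
-/

open Filter Topology

namespace SparseLCP

/-! ### The objective and feasible steps -/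

/-- The objective `⟨x, M x + q⟩`. -/
def obj (M : Matrix (Fin n) (Fin n) ℝ) (q x : Fin n → ℝ) : ℝ := x ⬝ᵥ (M *ᵥ x + q)

/-- The derivative of the objective at `x` in the direction `d`; `M` need not be symmetric. -/
def slope (M : Matrix (Fin n) (Fin n) ℝ) (q x d : Fin n → ℝ) : ℝ :=
  d ⬝ᵥ (M *ᵥ x + q) + x ⬝ᵥ (M *ᵥ d)

variable {s : ℕ} {M : Matrix (Fin n) (Fin n) ℝ} {q x d : Fin n → ℝ}

lemma obj_add_smul (M : Matrix (Fin n) (Fin n) ℝ) (q x d : Fin n → ℝ) (t : ℝ) :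
    obj M q (x + t • d) = obj M q x + t * slope M q x d + t ^ 2 * (d ⬝ᵥ (M *ᵥ d)) := by
  simp only [obj, slope, Matrix.mulVec_add, Matrix.mulVec_smul, add_dotProduct, dotProduct_add,
    smul_dotProduct, dotProduct_smul, smul_eq_mul]
  ring

lemma slope_add (M : Matrix (Fin n) (Fin n) ℝ) (q x d e : Fin n → ℝ) :
    slope M q x (d + e) = slope M q x d + slope M q x e := by
  simp only [slope, Matrix.mulVec_add, add_dotProduct, dotProduct_add]
  ring

lemma slope_smul (M : Matrix (Fin n) (Fin n) ℝ) (q x d : Fin n → ℝ) (t : ℝ) :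
    slope M q x (t • d) = t * slope M q x d := by
  simp only [slope, Matrix.mulVec_smul, smul_dotProduct, dotProduct_smul, smul_eq_mul]
  ring

lemma slope_neg (M : Matrix (Fin n) (Fin n) ℝ) (q x d : Fin n → ℝ) :
    slope M q x (-d) = -slope M q x d := by
  simpa using slope_smul M q x d (-1)

lemma slope_sum {ι : Type*} (M : Matrix (Fin n) (Fin n) ℝ) (q x : Fin n → ℝ) (I : Finset ι)
    (e : ι → Fin n → ℝ) : slope M q x (∑ i ∈ I, e i) = ∑ i ∈ I, slope M q x (e i) := by
  classical
  induction I using Finset.induction_on with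
  | empty => simp [slope]
  | insert a I ha ih => rw [Finset.sum_insert ha, Finset.sum_insert ha, slope_add, ih]

lemma slope_single (hM : M.IsSymm) (q x : Fin n → ℝ) (i : Fin n) :
    slope M q x (Pi.single i 1) = (M *ᵥ x + q) i + (M *ᵥ x) i := by
  have h : x ⬝ᵥ (M *ᵥ Pi.single i 1) = (M *ᵥ x) i := by
    rw [Matrix.dotProduct_mulVec, dotProduct_single_one, ← Matrix.mulVec_transpose, hM.eq]
  rw [slope, single_one_dotProduct, h]

lemma obj_nonneg_of_mem_fea (hx : x ∈ fea M q) : 0 ≤ obj M q x := by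
  unfold obj
  exact Finset.sum_nonneg fun i _ => mul_nonneg (hx.1 i) (hx.2 i)

lemma mem_sparse_of_eq_zero_off (J : Finset (Fin n)) (hJ : J.card ≤ s)
    (h : ∀ i ∉ J, x i = 0) : x ∈ sparse n s := by
  refine (Finset.card_le_card fun i hi => ?_).trans hJ
  by_contra hiJ
  exact (Finset.mem_filter.1 hi).2 (h i hiJ)

lemma eq_zero_of_notMem_supp {i : Fin n} (h : i ∉ supp x) : x i = 0 := by
  by_contra h0
  exact h (Finset.mem_filter.2 ⟨Finset.mem_univ _, h0⟩)

lemma isClosed_fea (M : Matrix (Fin n) (Fin n) ℝ) (q : Fin n → ℝ) : IsClosed (fea M q) := by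
  refine IsClosed.inter (isClosed_le (f := fun _ => 0) (g := id) ?_ ?_)
    (isClosed_le (f := fun _ => 0) (g := fun x => M *ᵥ x + q) ?_ ?_) <;> fun_prop

/-- The sparse set is a finite union of coordinate subspaces. -/
lemma isClosed_sparse (n s : ℕ) : IsClosed (sparse n s) := by
  have h : sparse n s = ⋃ J ∈ {J : Finset (Fin n) | J.card ≤ s}, {x | ∀ i ∉ J, x i = 0} := by
    ext x
    simp only [Set.mem_iUnion, Set.mem_ofPred_eq, exists_prop]
    exact ⟨fun hx => ⟨supp x, hx, fun i => eq_zero_of_notMem_supp⟩,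
      fun ⟨J, hJ, h⟩ => mem_sparse_of_eq_zero_off J hJ h⟩
  rw [h]
  refine (Set.toFinite _).isClosed_biUnion fun J _ => ?_
  simp only [Set.ofPred_forall]
  exact isClosed_iInter fun i => isClosed_iInter fun _ =>
    isClosed_eq (continuous_apply i) continuous_const

lemma isClosed_feaS (s : ℕ) (M : Matrix (Fin n) (Fin n) ℝ) (q : Fin n → ℝ) :
    IsClosed (feaS s M q) := (isClosed_fea M q).inter (isClosed_sparse n s)

lemma continuous_obj (M : Matrix (Fin n) (Fin n) ℝ) (q : Fin n → ℝ) :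
    Continuous (obj M q) := by
  unfold obj
  fun_prop

lemma eventually_add_mul_nonneg {a b : ℝ} (ha : 0 ≤ a) (h : a = 0 → 0 ≤ b) :
    ∀ᶠ t in 𝓝[>] (0 : ℝ), 0 ≤ a + t * b := by
  rcases ha.eq_or_lt with h0 | h0
  · filter_upwards [self_mem_nhdsWithin] with t ht
    rw [← h0, zero_add]
    exact mul_nonneg (le_of_lt ht) (h h0.symm)
  · have hc : Tendsto (fun t : ℝ => a + t * b) (𝓝 0) (𝓝 (a + 0 * b)) :=
      Continuous.tendsto (by fun_prop) 0
    rw [zero_mul, add_zero] at hc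
    exact nhdsWithin_le_nhds ((hc.eventually_const_lt h0).mono fun _ => le_of_lt)

lemma eventually_add_smul_mem_fea (hx : x ∈ fea M q) (hd : ∀ i, x i = 0 → 0 ≤ d i)
    (hMd : ∀ i, (M *ᵥ x + q) i = 0 → 0 ≤ (M *ᵥ d) i) :
    ∀ᶠ t in 𝓝[>] (0 : ℝ), x + t • d ∈ fea M q := by
  filter_upwards [eventually_all.2 fun i => eventually_add_mul_nonneg (hx.1 i) (hd i),
    eventually_all.2 fun i => eventually_add_mul_nonneg (hx.2 i) (hMd i)] with t h1 h2
  refine ⟨h1, fun i => ?_⟩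
  have := h2 i
  simp only [Matrix.mulVec_add, Matrix.mulVec_smul, Pi.add_apply, Pi.smul_apply,
    smul_eq_mul] at this ⊢
  linarith

/-! ### Existence of a minimizer -/

lemma isCompact_inter_sum_le {C : Set (Fin n → ℝ)} (hC : IsClosed C)
    (h0 : ∀ x ∈ C, ∀ i, 0 ≤ x i) (B : ℝ) : IsCompact (C ∩ {x | ∑ i, x i ≤ B}) := by
  refine (isCompact_Icc (a := (0 : Fin n → ℝ)) (b := fun _ => B)).of_isClosed_subset
    (hC.inter (isClosed_le (by fun_prop) continuous_const)) fun x hx => ⟨h0 x hx.1, fun i => ?_⟩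
  exact (Finset.single_le_sum (fun j _ => h0 x hx.1 j) (Finset.mem_univ i)).trans hx.2

lemma exists_sum_le {C : Set (Fin n → ℝ)} (hC : IsClosed C) (h0 : ∀ x ∈ C, ∀ i, 0 ≤ x i)
    (hne : C.Nonempty) : ∃ x ∈ C, ∀ z ∈ C, ∑ i, x i ≤ ∑ i, z i := by
  obtain ⟨w, hw⟩ := hne
  obtain ⟨x, hx, hmin⟩ := (isCompact_inter_sum_le hC h0 (∑ i, w i)).exists_isMinOn
    ⟨w, hw, le_refl (∑ i, w i)⟩ (f := fun x => ∑ i, x i) (by fun_prop)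
  refine ⟨x, hx.1, fun z hz => ?_⟩
  rcases le_total (∑ i, z i) (∑ i, w i) with h | h
  · exact hmin ⟨hz, h⟩
  · exact le_trans hx.2 h

/-- A short step back along a recession direction `d` with `⟨d, M d⟩ = 0` stays feasible, does not
increase the objective, and decreases the sum of the coordinates, provided that `x` and `M x + q`
are nonzero wherever `d` and `M d` are. -/
lemma exists_smaller_sum_of_recession (hx : x ∈ feaS s M q) (hd : d ∈ stdSimplex ℝ (Fin n))
    (hMd : ∀ i, 0 ≤ (M *ᵥ d) i) (hdMd : d ⬝ᵥ (M *ᵥ d) = 0) (h1 : ∀ i, x i = 0 → d i = 0)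
    (h2 : ∀ i, (M *ᵥ x + q) i = 0 → (M *ᵥ d) i = 0) :
    ∃ z ∈ feaS s M q, obj M q z ≤ obj M q x ∧ ∑ i, z i < ∑ i, x i := by
  have hslope : 0 ≤ slope M q x d := by
    by_contra! hneg
    -- The affine function `t ↦ obj x + t * slope` would be negative at this `t`.
    set t : ℝ := (obj M q x + 1) / -slope M q x d
    have hobj := obj_nonneg_of_mem_fea hx.1
    have ht0 : 0 ≤ t := div_nonneg (by linarith) (by linarith)
    have hmem : x + t • d ∈ fea M q := by
      refine ⟨fun i => add_nonneg (hx.1.1 i) (mul_nonneg ht0 (hd.1 i)), fun i => ?_⟩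
      have := hx.1.2 i
      have := mul_nonneg ht0 (hMd i)
      simp only [Matrix.mulVec_add, Matrix.mulVec_smul, Pi.add_apply, Pi.smul_apply,
        smul_eq_mul] at *
      linarith
    have h := obj_nonneg_of_mem_fea hmem
    have : t * -slope M q x d = obj M q x + 1 := div_mul_cancel₀ _ (by linarith)
    rw [obj_add_smul, hdMd] at h
    linarith
  have hev := eventually_add_smul_mem_fea (d := -d) hx.1 (fun i hi => by simp [h1 i hi])
    (fun i hi => by simp [Matrix.mulVec_neg, h2 i hi])
  obtain ⟨t, hmem, ht⟩ := (hev.and self_mem_nhdsWithin).exists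
  have ht : 0 < t := ht
  refine ⟨x + t • -d, ⟨hmem, mem_sparse_of_eq_zero_off (supp x) hx.2 fun i hi => ?_⟩, ?_, ?_⟩
  · have hxi := eq_zero_of_notMem_supp hi
    simp [hxi, h1 i hxi]
  · have := mul_nonneg ht.le hslope
    rw [obj_add_smul, slope_neg, Matrix.mulVec_neg, neg_dotProduct_neg, hdMd]
    linarith
  · have : ∑ i, (x + t • -d) i = ∑ i, x i - t * ∑ i, d i := by
      simp [Finset.sum_add_distrib, Finset.mul_sum, sub_eq_add_neg]
    rw [this, hd.2]
    linarith

/-- Feasible points with bounded objective whose coordinate sums tend to infinity accumulate, after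
normalization, at a recession direction `d` with `⟨d, M d⟩ = 0`, and some of them satisfy the strict
positivity that permits a step back along `d`. -/
lemma exists_recession {u : ℕ → Fin n → ℝ} (hu : ∀ k, u k ∈ fea M q) {B : ℝ}
    (hB : ∀ k, obj M q (u k) ≤ B) (hsum : Tendsto (fun k => ∑ i, u k i) atTop atTop) :
    ∃ d ∈ stdSimplex ℝ (Fin n), (∀ i, 0 ≤ (M *ᵥ d) i) ∧ d ⬝ᵥ (M *ᵥ d) = 0 ∧
      ∃ k, (∀ i, u k i = 0 → d i = 0) ∧
        ∀ i, (M *ᵥ u k + q) i = 0 → (M *ᵥ d) i = 0 := by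
  set r : ℕ → ℝ := fun k => (∑ i, u k i)⁻¹
  have hpos : ∀ᶠ k in atTop, 0 < ∑ i, u k i := hsum.eventually_gt_atTop 0
  have hsimplex : ∀ᶠ k in atTop, r k • u k ∈ stdSimplex ℝ (Fin n) := by
    filter_upwards [hpos] with k hk
    refine ⟨fun i => mul_nonneg (inv_nonneg.2 hk.le) ((hu k).1 i), ?_⟩
    simp only [Pi.smul_apply, smul_eq_mul, ← Finset.mul_sum]
    exact inv_mul_cancel₀ hk.ne'
  obtain ⟨d, hd, φ, hφ, hlim⟩ :=
    (isCompact_stdSimplex ℝ (Fin n)).tendsto_subseq' hsimplex.frequently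
  have hφt := hφ.tendsto_atTop
  have hr0 : Tendsto (fun k => r (φ k)) atTop (𝓝 0) := (tendsto_inv_atTop_zero.comp hsum).comp hφt
  have hlimM : Tendsto (fun k => r (φ k) • (M *ᵥ u (φ k) + q)) atTop (𝓝 (M *ᵥ d)) := by
    have h1 : Tendsto (fun k => M *ᵥ (r (φ k) • u (φ k)) + r (φ k) • q) atTop
        (𝓝 (M *ᵥ d + (0 : ℝ) • q)) :=
      (((Continuous.tendsto (by fun_prop : Continuous fun v => M *ᵥ v) d).comp hlim)).add
        (hr0.smul_const q)
    simpa only [Matrix.mulVec_smul, ← smul_add, zero_smul, add_zero] using h1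
  have hlim' := tendsto_pi_nhds.1 hlim
  have hlimM' := tendsto_pi_nhds.1 hlimM
  have hposφ := hφt.eventually hpos
  have hMd : ∀ i, 0 ≤ (M *ᵥ d) i := fun i => by
    refine ge_of_tendsto (hlimM' i) ?_
    filter_upwards [hposφ] with k hk
    exact mul_nonneg (inv_nonneg.2 hk.le) ((hu _).2 i)
  have hdMd : d ⬝ᵥ (M *ᵥ d) ≤ 0 := by
    have h1 : Tendsto (fun k => (r (φ k) • u (φ k)) ⬝ᵥ (r (φ k) • (M *ᵥ u (φ k) + q))) atTop
        (𝓝 (d ⬝ᵥ (M *ᵥ d))) :=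
      tendsto_finsetSum _ fun i _ => (hlim' i).mul (hlimM' i)
    have h2 : Tendsto (fun k => r (φ k) * (r (φ k) * B)) atTop (𝓝 (0 * (0 * B))) :=
      hr0.mul (hr0.mul_const B)
    rw [zero_mul] at h2
    refine le_of_tendsto_of_tendsto h1 h2 ?_
    filter_upwards [hposφ] with k hk
    have hrk : 0 ≤ r (φ k) := inv_nonneg.2 hk.le
    rw [smul_dotProduct, dotProduct_smul]
    exact mul_le_mul_of_nonneg_left (mul_le_mul_of_nonneg_left (hB _) hrk) hrk
  have hev1 : ∀ᶠ k in atTop, ∀ i, u (φ k) i = 0 → d i = 0 := by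
    refine eventually_all.2 fun i => ?_
    rcases (hd.1 i).eq_or_lt with h | h
    · exact Eventually.of_forall fun _ _ => h.symm
    · filter_upwards [(hlim' i).eventually_const_lt h] with k hk h0
      simp [h0] at hk
  have hev2 : ∀ᶠ k in atTop, ∀ i, (M *ᵥ u (φ k) + q) i = 0 → (M *ᵥ d) i = 0 := by
    refine eventually_all.2 fun i => ?_
    rcases (hMd i).eq_or_lt with h | h
    · exact Eventually.of_forall fun _ _ => h.symm
    · filter_upwards [(hlimM' i).eventually_const_lt h] with k hk h0
      rw [Pi.smul_apply, h0, smul_zero] at hk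
      exact absurd hk (lt_irrefl 0)
  obtain ⟨k, hk1, hk2⟩ := (hev1.and hev2).exists
  exact ⟨d, hd, hMd, le_antisymm hdMd (Finset.sum_nonneg fun i _ => mul_nonneg (hd.1 i) (hMd i)),
    φ k, hk1, hk2⟩

theorem argminS_nonempty (h : (feaS s M q).Nonempty) : (argminS s M q).Nonempty := by
  set m := sInf (obj M q '' feaS s M q)
  have hbdd : BddBelow (obj M q '' feaS s M q) :=
    ⟨0, by rintro _ ⟨x, hx, rfl⟩; exact obj_nonneg_of_mem_fea hx.1⟩
  have hle : ∀ z ∈ feaS s M q, m ≤ obj M q z := fun z hz => csInf_le hbdd ⟨z, hz, rfl⟩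
  have hex : ∀ k : ℕ, ∃ x ∈ {x | x ∈ feaS s M q ∧ obj M q x ≤ m + 1 / ((k : ℝ) + 1)},
      ∀ z ∈ {x | x ∈ feaS s M q ∧ obj M q x ≤ m + 1 / ((k : ℝ) + 1)},
        ∑ i, x i ≤ ∑ i, z i := fun k => by
    refine exists_sum_le ((isClosed_feaS s M q).inter
      (isClosed_le (continuous_obj M q) continuous_const)) (fun x hx => hx.1.1.1) ?_
    obtain ⟨_, ⟨x, hx, rfl⟩, hlt⟩ := exists_lt_of_csInf_lt (h.image (obj M q))
      (lt_add_of_pos_right m (Nat.one_div_pos_of_nat (n := k) (α := ℝ)))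
    exact ⟨x, hx, hlt.le⟩
  choose u hu hmin using hex
  by_cases hsum : Tendsto (fun k => ∑ i, u k i) atTop atTop
  · have hB : ∀ k, obj M q (u k) ≤ m + 1 := fun k =>
      (hu k).2.trans (by
        have : 1 / ((k : ℝ) + 1) ≤ 1 := by
          rw [div_le_one (by positivity)]
          simp
        linarith)
    obtain ⟨d, hd, hMd, hdMd, k, h1, h2⟩ := exists_recession (fun k => (hu k).1.1) hB hsum
    obtain ⟨z, hz, hzobj, hzsum⟩ :=
      exists_smaller_sum_of_recession (hu k).1 hd hMd hdMd h1 h2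
    exact absurd (hmin k z ⟨hz, hzobj.trans (hu k).2⟩) (not_le.2 hzsum)
  · rw [tendsto_atTop] at hsum
    push Not at hsum
    obtain ⟨B, hB⟩ := hsum
    have hfreq : ∃ᶠ k in atTop, u k ∈ feaS s M q ∩ {x | ∑ i, x i ≤ B} :=
      hB.mono fun k hk => ⟨(hu k).1, le_of_lt (by simpa using hk)⟩
    obtain ⟨x, hx, φ, hφ, hlim⟩ :=
      (isCompact_inter_sum_le (isClosed_feaS s M q) (fun x hx => hx.1.1) B).tendsto_subseq' hfreq
    have hxm : obj M q x ≤ m := by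
      have h1 := ((continuous_obj M q).tendsto x).comp hlim
      have h2 : Tendsto (fun k => m + 1 / ((φ k : ℝ) + 1)) atTop (𝓝 (m + 0)) :=
        (tendsto_one_div_add_atTop_nhds_zero_nat.comp hφ.tendsto_atTop).const_add m
      rw [add_zero] at h2
      exact le_of_tendsto_of_tendsto' h1 h2 fun k => (hu (φ k)).2
    exact ⟨x, hx.1, fun z hz => hxm.trans (hle z hz)⟩

/-! ### First-order conditions and complementarity -/

/-- The first-order necessary condition: the direction may use any coordinates `J` around the
support of `x` as long as there are at most `s` of them. -/
lemma slope_nonneg_of_mem_argminS (hx : x ∈ argminS s M q) (J : Finset (Fin n)) (hJ : J.card ≤ s)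
    (hxJ : ∀ i ∉ J, x i = 0) (hdJ : ∀ i ∉ J, d i = 0) (hd : ∀ i, x i = 0 → 0 ≤ d i)
    (hMd : ∀ i, (M *ᵥ x + q) i = 0 → 0 ≤ (M *ᵥ d) i) : 0 ≤ slope M q x d := by
  have hlim : Tendsto (fun t : ℝ => slope M q x d + t * (d ⬝ᵥ (M *ᵥ d))) (𝓝[>] 0)
      (𝓝 (slope M q x d)) := by
    have : Tendsto (fun t : ℝ => slope M q x d + t * (d ⬝ᵥ (M *ᵥ d))) (𝓝 0)
        (𝓝 (slope M q x d + 0 * (d ⬝ᵥ (M *ᵥ d)))) := Continuous.tendsto (by fun_prop) 0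
    rw [zero_mul, add_zero] at this
    exact this.mono_left nhdsWithin_le_nhds
  refine ge_of_tendsto hlim ?_
  filter_upwards [eventually_add_smul_mem_fea hx.1.1 hd hMd, self_mem_nhdsWithin] with t hmem ht
  have ht : 0 < t := ht
  have hle : obj M q x ≤ obj M q (x + t • d) :=
    hx.2 _ ⟨hmem, mem_sparse_of_eq_zero_off J hJ fun i hi => by simp [hxJ i hi, hdJ i hi]⟩
  rw [obj_add_smul] at hle
  refine nonneg_of_mul_nonneg_right (a := t) ?_ ht
  linarith

lemma complementary_of_isZMatrix (hx : x ∈ argminS s M q) (hM : M.IsSymm) (hZ : IsZMatrix M)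
    (hq : ∀ i ∈ supp x, q i ≤ 0) : x ⬝ᵥ (M *ᵥ x + q) = 0 := by
  refine Finset.sum_eq_zero fun i _ => ?_
  by_contra hne
  obtain ⟨hxi, hyi⟩ := mul_ne_zero_iff.1 hne
  have hyi : 0 < (M *ᵥ x + q) i := lt_of_le_of_ne (hx.1.1.2 i) (Ne.symm hyi)
  have hi : i ∈ supp x := Finset.mem_filter.2 ⟨Finset.mem_univ i, hxi⟩
  have h : 0 ≤ slope M q x (-Pi.single i 1) := by
    refine slope_nonneg_of_mem_argminS hx (supp x) hx.1.2 (fun j => eq_zero_of_notMem_supp)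
      (fun j hj => ?_) (fun j hj => ?_) (fun j hj => ?_)
    · simp [show j ≠ i from fun h => hj (h ▸ hi)]
    · simp [show j ≠ i from fun h => hxi (h ▸ hj)]
    · have hji : j ≠ i := fun h => hyi.ne' (h ▸ hj)
      simpa [Matrix.mulVec_neg] using hZ j i hji
  rw [slope_neg, slope_single hM] at h
  have := hq i hi
  simp only [Pi.add_apply] at h hyi
  linarith

/-- Full column rank of `M_{TΓ}`, for symmetric `M`, makes every unit vector of `ℝ^Γ` the image of a
vector supported on `T` under the rows of `M` indexed by `Γ`. -/
lemma exists_dual_vectors (hM : M.IsSymm) {T Γ : Finset (Fin n)}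
    (hrank : (blockSub M T Γ).rank = Γ.card) :
    ∃ r : Fin n → Fin n → ℝ, ∀ i ∈ Γ, (∀ j ∉ T, r i j = 0) ∧
      ∀ k ∈ Γ, (M *ᵥ r i) k = if k = i then 1 else 0 := by
  have hsurj : Function.Surjective (blockSub M T Γ)ᵀ.mulVecLin := by
    rw [← LinearMap.range_eq_top]
    apply Submodule.eq_top_of_finrank_eq
    rw [← Matrix.rank, Matrix.rank_transpose, hrank]
    simp
  have hex : ∀ i, ∃ r : Fin n → ℝ, i ∈ Γ → (∀ j ∉ T, r j = 0) ∧
      ∀ k ∈ Γ, (M *ᵥ r) k = if k = i then 1 else 0 := fun i => by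
    obtain ⟨v, hv⟩ := hsurj fun k => if (k : Fin n) = i then 1 else 0
    refine ⟨fun j => if h : j ∈ T then v ⟨j, h⟩ else 0, fun _ => ⟨fun j hj => by simp [hj],
      fun k hk => ?_⟩⟩
    have hvk := congrFun hv ⟨k, hk⟩
    simp only [Matrix.mulVecLin_apply] at hvk
    rw [← hvk]
    simp only [Matrix.mulVec, dotProduct, Matrix.transpose_apply, blockSub, Matrix.submatrix_apply]
    rw [← Finset.sum_subset (Finset.subset_univ T) (fun j _ hj => by simp [hj]),
      ← Finset.sum_coe_sort T]
    refine Finset.sum_congr rfl fun j _ => ?_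
    rw [dif_pos j.2, hM.apply]
  choose r hr using hex
  exact ⟨r, hr⟩

/-- Karush–Kuhn–Tucker multipliers: `l` for the constraints `M x + q ≥ 0` and `μ`, the residual
`(M x + q) + M x - M l` of the gradient, for the constraints `x ≥ 0`. -/
lemma exists_multipliers (hx : x ∈ argminS s M q) (hs : zeroNorm x < s) (hM : M.IsSymm)
    (hrank : (blockSub M (supp x) (activeSet M q x)).rank = (activeSet M q x).card) :
    ∃ l μ : Fin n → ℝ, M *ᵥ x + (M *ᵥ x + q) = M *ᵥ l + μ ∧ (∀ i, 0 ≤ l i) ∧ (∀ i, 0 ≤ μ i) ∧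
      l ⬝ᵥ (M *ᵥ x + q) = 0 ∧ x ⬝ᵥ μ = 0 := by
  have hΓ : ∀ {i}, i ∈ activeSet M q x ↔ (M *ᵥ x + q) i = 0 := by simp [activeSet]
  obtain ⟨r, hr⟩ := exists_dual_vectors hM hrank
  -- The direction `e j` corrected on the support of `x` so that the active constraints stay active.
  obtain ⟨e, he⟩ : ∃ e : Fin n → Fin n → ℝ, ∀ j,
      e j = Pi.single j 1 - ∑ i ∈ activeSet M q x, M i j • r i := ⟨_, fun _ => rfl⟩
  have hMe : ∀ j k, (M *ᵥ x + q) k = 0 → (M *ᵥ e j) k = 0 := fun j k hk => by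
    have hsum : (M *ᵥ ∑ i ∈ activeSet M q x, M i j • r i) k =
        ∑ i ∈ activeSet M q x, M i j * (M *ᵥ r i) k := by
      simp [Matrix.mulVec_sum, Matrix.mulVec_smul, Finset.sum_apply]
    have hsum' : ∑ i ∈ activeSet M q x, M i j * (M *ᵥ r i) k = M k j := by
      rw [Finset.sum_eq_single_of_mem k (hΓ.2 hk)]
      · simp [(hr k (hΓ.2 hk)).2 k (hΓ.2 hk)]
      · intro i hi hik
        simp [(hr i hi).2 k (hΓ.2 hk), hik.symm]
    rw [he, Matrix.mulVec_sub, Pi.sub_apply, hsum, hsum']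
    simp
  have he0 : ∀ j, ∀ i ∉ supp x, i ≠ j → e j i = 0 := fun j i hi hij => by
    have : (∑ k ∈ activeSet M q x, M k j • r k) i = 0 := by
      rw [Finset.sum_apply]
      exact Finset.sum_eq_zero fun k hk => by simp [(hr k hk).1 i hi]
    rw [he, Pi.sub_apply, this]
    simp [hij]
  have hej : ∀ j ∉ supp x, e j j = 1 := fun j hj => by
    have : (∑ k ∈ activeSet M q x, M k j • r k) j = 0 := by
      rw [Finset.sum_apply]
      exact Finset.sum_eq_zero fun k hk => by simp [(hr k hk).1 j hj]
    rw [he, Pi.sub_apply, this]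
    simp
  have hμ0 : ∀ j, 0 ≤ slope M q x (e j) := fun j => by
    classical
    refine slope_nonneg_of_mem_argminS hx (insert j (supp x))
      ((Finset.card_insert_le _ _).trans hs) (fun i hi => ?_) (fun i hi => ?_) (fun i hi => ?_)
      (fun i hi => (hMe j i hi).ge)
    · exact eq_zero_of_notMem_supp fun h => hi (Finset.mem_insert_of_mem h)
    · exact he0 j i (fun h => hi (Finset.mem_insert_of_mem h))
        fun h => hi (h ▸ Finset.mem_insert_self _ _)
    · have his : i ∉ supp x := by simp [supp, hi]
      by_cases hij : i = j
      · subst hij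
        simp [hej i his]
      · exact (he0 j i his hij).ge
  have hμT : ∀ j ∈ supp x, slope M q x (e j) ≤ 0 := fun j hj => by
    have h : 0 ≤ slope M q x (-e j) := by
      have hz : ∀ i ∉ supp x, (-e j) i = 0 := fun i hi => by
        simp [he0 j i hi fun h => hi (h ▸ hj)]
      refine slope_nonneg_of_mem_argminS hx (supp x) hx.1.2 (fun i => eq_zero_of_notMem_supp) hz
        (fun i hi => (hz i (by simp [supp, hi])).ge) (fun i hi => ?_)
      simp [Matrix.mulVec_neg, hMe j i hi]
    rw [slope_neg] at h
    linarith
  classical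
  refine ⟨fun i => if i ∈ activeSet M q x then slope M q x (r i) else 0,
    fun j => slope M q x (e j), ?_, fun i => ?_, hμ0, ?_, ?_⟩
  · ext j
    have h1 : slope M q x (e j) = (M *ᵥ x + q) j + (M *ᵥ x) j -
        ∑ i ∈ activeSet M q x, M i j * slope M q x (r i) := by
      rw [he, sub_eq_add_neg, slope_add, slope_neg, slope_single hM, slope_sum]
      simp only [slope_smul]
      ring
    have h2 : (M *ᵥ fun i => if i ∈ activeSet M q x then slope M q x (r i) else 0) j =
        ∑ i ∈ activeSet M q x, M i j * slope M q x (r i) := by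
      simp only [Matrix.mulVec, dotProduct, mul_ite, mul_zero, Finset.sum_ite_mem,
        Finset.univ_inter]
      exact Finset.sum_congr rfl fun i _ => by rw [hM.apply]
    have h3 := Pi.add_apply (M *ᵥ x) (M *ᵥ x + q) j
    refine h3.trans (Eq.trans ?_ (congrArg₂ (· + ·) h2 h1).symm)
    ring
  · dsimp only
    split_ifs with hi
    · have hz : ∀ j ∉ supp x, r i j = 0 := (hr i hi).1
      refine slope_nonneg_of_mem_argminS hx (supp x) hx.1.2 (fun i => eq_zero_of_notMem_supp) hz
        (fun j hj => (hz j (by simp [supp, hj])).ge) (fun k hk => ?_)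
      rw [(hr i hi).2 k (hΓ.2 hk)]
      split_ifs <;> norm_num
    · exact le_rfl
  · refine Finset.sum_eq_zero fun i _ => ?_
    dsimp only
    split_ifs with hi
    · rw [hΓ.1 hi, mul_zero]
    · rw [zero_mul]
  · refine Finset.sum_eq_zero fun j _ => ?_
    by_cases hj : j ∈ supp x
    · simp [le_antisymm (hμT j hj) (hμ0 j)]
    · simp [eq_zero_of_notMem_supp hj]

lemma complementary_of_posSemidef (hx : x ∈ argminS s M q) (hs : zeroNorm x < s)
    (hM : M.PosSemidef)
    (hrank : (blockSub M (supp x) (activeSet M q x)).rank = (activeSet M q x).card) :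
    x ⬝ᵥ (M *ᵥ x + q) = 0 := by
  have hsymm : M.IsSymm := by simpa using hM.isHermitian
  obtain ⟨l, μ, hkkt, hl, hμ, hly, hxμ⟩ := exists_multipliers hx hs hsymm hrank
  have hdiff : M *ᵥ (x - l) = μ - (M *ᵥ x + q) := by
    rw [Matrix.mulVec_sub]
    linear_combination hkkt
  have hpsd : 0 ≤ (x - l) ⬝ᵥ (M *ᵥ (x - l)) := by
    simpa using hM.dotProduct_mulVec_nonneg (x - l)
  rw [hdiff, sub_dotProduct, dotProduct_sub, dotProduct_sub, hly, hxμ] at hpsd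
  have hlμ : 0 ≤ l ⬝ᵥ μ := Finset.sum_nonneg fun i _ => mul_nonneg (hl i) (hμ i)
  have hxy : 0 ≤ x ⬝ᵥ (M *ᵥ x + q) := obj_nonneg_of_mem_fea hx.1.1
  linarith

end SparseLCP

theorem theorem4p2 (n s : ℕ) (M : Matrix (Fin n) (Fin n) ℝ) (q : Fin n → ℝ)
    (hfea : (SparseLCP.feaS s M q).Nonempty) :
    (SparseLCP.argminS s M q).Nonempty ∧
    ∀ x ∈ SparseLCP.argminS s M q,
      ((SparseLCP.zeroNorm x = s ∧ M.IsSymm ∧ SparseLCP.IsZMatrix M ∧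
          (SparseLCP.colSub M (SparseLCP.supp x)).rank = (SparseLCP.supp x).card ∧
          ∀ i ∈ SparseLCP.supp x, q i ≤ 0) ∨
        (SparseLCP.zeroNorm x < s ∧ M.IsSymm ∧ SparseLCP.IsZMatrix M ∧
          (SparseLCP.blockSub M (SparseLCP.supp x) (SparseLCP.activeSet M q x)).rank =
            (SparseLCP.activeSet M q x).card ∧
          ∀ i ∈ SparseLCP.supp x, q i ≤ 0) ∨
        (SparseLCP.zeroNorm x < s ∧ M.PosSemidef ∧
          (SparseLCP.blockSub M (SparseLCP.supp x) (SparseLCP.activeSet M q x)).rank =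
            (SparseLCP.activeSet M q x).card)) →
      x ∈ SparseLCP.sol M q ∩ SparseLCP.sparse n s := by
  refine ⟨SparseLCP.argminS_nonempty hfea, fun x hx h => ⟨⟨hx.1.1.1, hx.1.1.2, ?_⟩, hx.1.2⟩⟩
  rcases h with ⟨_, hM, hZ, _, hq⟩ | ⟨_, hM, hZ, _, hq⟩ | ⟨hs, hM, hrank⟩
  · exact SparseLCP.complementary_of_isZMatrix hx hM hZ hq
  · exact SparseLCP.complementary_of_isZMatrix hx hM hZ hq
  · exact SparseLCP.complementary_of_posSemidef hx hs hM hrank
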